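/- Let $\varphi_0,\varphi_1,\dots$ be the standard enumeration of the unary partial recursive functions and $W_e=\mathrm{dom}(\varphi_e)\subseteq\mathbb{N}$. Fix a finite first-order signature $L$ and a G\"odel numbering $\sigma\mapsto\ulcorner\sigma\urcorner\in\mathbb{N}$ of the $L$-sentences, i.e. an injective (for example bijective) map such that the number of a sentence can be computed from the sentence and the sentence can be recovered effectively from its number. A \emph{theory} is a set $T$ of $L$-sentences which is equal to the set of sentences provable from $T$ in classical first-order logic with equality; it is identified with the set $\{\ulcorner\sigma\urcorner:\sigma\in T\}$ of the G\"odel numbers of its elements. A disjoint pair $(A,B)$ of recursively enumerable subsets of $\mathbb{N}$ is \emph{effectively inseparable} if there is a (total) recursive function $f(x,y)$ such that for all $i,j$: if $A\subseteq W_i$, $B\subseteq W_j$ and $W_i\cap W_j=\emptyset$, then $f(i,j)\notin W_i\cup W_j$. A consistent recursively enumerable theory $T$ is an \emph{EI theory} if the pair $(T_P,T_R)$ is effectively inseparable, where $T_P=\{\ulcorner\sigma\urcorner: T\vdash\sigma\}$ and $T_R=\{\ulcorner\sigma\urcorner: T\vdash\neg\sigma\}$. \textbf{Theorem.} The set $\{e\in\mathbb{N}: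 W_e \text{ is an EI theory}\}$ is $\Sigma^0_3$, i.e. there is a recursive relation $R\subseteq\mathbb{N}^4$ such that for every $e$: $W_e$ is an EI theory if and only if $\exists x\,\forall y\,\exists z\,R(e,x,y,z)$. -/

import Mathlib

universe u v

namespace EITheory

open FirstOrder.Language (Term BoundedFormula)

/-! ### Recursively enumerable sets, the arithmetical hierarchy, effective inseparability -/

/-- `W e` is the domain of the `e`-th partial recursive function. -/
def W (e : ℕ) : Set ℕ :=
  {x | ((Denumerable.ofNat Nat.Partrec.Code e).eval x).Dom}

/-- `IsSigma n A` : the set `A` is `Σ⁰ₙ`.  A set is `Σ⁰₀` if it is recursive, and it is `Σ⁰ₙ₊₁` if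
it is of the form `{x | ∃ y, ⟨x, y⟩ ∈ B}` with `B` a `Π⁰ₙ` set, i.e. the complement of a `Σ⁰ₙ`
set. -/
def IsSigma : ℕ → Set ℕ → Prop
  | 0, A => ComputablePred fun x => x ∈ A
  | n + 1, A => ∃ B : Set ℕ, IsSigma n Bᶜ ∧ A = {x | ∃ y, Nat.pair x y ∈ B}

/-- The pair `(A, B)` is an effectively inseparable disjoint pair of recursively enumerable sets. -/
def EffectivelyInseparable (A B : Set ℕ) : Prop :=
  REPred (fun x => x ∈ A) ∧ REPred (fun x => x ∈ B) ∧ A ∩ B = ∅ ∧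
    ∃ f : ℕ → ℕ → ℕ, Computable₂ f ∧
      ∀ i j, A ⊆ W i → B ⊆ W j → W i ∩ W j = ∅ → f i j ∉ W i ∪ W j

variable {L : FirstOrder.Language.{u, v}}

/-! ### Substitution

A formula `φ : L.BoundedFormula Empty n` has its free variables among the `n` variables
`0, …, n - 1`; the quantifier in `φ.all` binds the variable `n`. -/

/-- Terms in the variables `0, …, n - 1`. -/
abbrev Tm (L : FirstOrder.Language.{u, v}) (n : ℕ) := L.Term (Empty ⊕ Fin n)

/-- Formulas in the free variables `0, …, n - 1`.  Thus `Fm L 0` is `L.Sentence`. -/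
abbrev Fm (L : FirstOrder.Language.{u, v}) (n : ℕ) := L.BoundedFormula Empty n

/-- The `i`-th variable, as a term. -/
def bvar {n : ℕ} (i : Fin n) : Tm L n := Term.var (Sum.inr i)

/-- Simultaneous substitution in a term. -/
def tsub {m n : ℕ} (t : Tm L m) (σ : Fin m → Tm L n) : Tm L n :=
  Term.subst t (Sum.elim (fun e => Empty.elim e) σ)

/-- Simultaneous capture-avoiding substitution in a formula: under a quantifier, the bound variable
`m` becomes the bound variable `n`. -/
def fsub : ∀ {m : ℕ}, Fm L m → ∀ {n : ℕ}, (Fin m → Tm L n) → Fm L n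
  | _, .falsum, _, _ => .falsum
  | _, .equal t s, _, σ => .equal (tsub t σ) (tsub s σ)
  | _, .rel R ts, _, σ => .rel R fun i => tsub (ts i) σ
  | _, .imp φ ψ, _, σ => .imp (fsub φ σ) (fsub ψ σ)
  | m, .all φ, n, σ =>
      .all (fsub φ (Fin.snoc (α := fun _ : Fin (m + 1) => Tm L (n + 1))
        (fun i => tsub (σ i) fun k => bvar k.castSucc) (bvar (Fin.last n))))

/-- `φ(t)`, where `φ` is a formula in the variables `0, …, n` and `t` is put for the variable `n`. -/
def inst {n : ℕ} (φ : Fm L (n + 1)) (t : Tm L n) : Fm L n :=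
  fsub φ (Fin.snoc (α := fun _ : Fin (n + 1) => Tm L n) bvar t)

/-- `φ`, regarded as a formula with the additional free variable `n`, which does not occur. -/
def lift {n : ℕ} (φ : Fm L n) : Fm L (n + 1) :=
  fsub φ fun i => bvar i.castSucc

/-! ### Classical first-order logic with equality

A Hilbert calculus for sentences: the logical axioms are the universal closures of the formulas
below, and modus ponens is the only rule. -/

/-- The formulas whose universal closures are the logical axioms. -/
inductive LogicalAxiom : ∀ {n : ℕ}, Fm L n → Prop
  | imp_intro {n : ℕ} (φ ψ : Fm L n) : LogicalAxiom (φ.imp (ψ.imp φ))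
  | imp_distrib {n : ℕ} (φ ψ χ : Fm L n) :
      LogicalAxiom ((φ.imp (ψ.imp χ)).imp ((φ.imp ψ).imp (φ.imp χ)))
  | not_not {n : ℕ} (φ : Fm L n) : LogicalAxiom (φ.not.not.imp φ)
  | all_elim {n : ℕ} (φ : Fm L (n + 1)) (t : Tm L n) : LogicalAxiom (φ.all.imp (inst φ t))
  | all_distrib {n : ℕ} (φ ψ : Fm L (n + 1)) :
      LogicalAxiom ((φ.imp ψ).all.imp (φ.all.imp ψ.all))
  | all_vacuous {n : ℕ} (φ : Fm L n) : LogicalAxiom (φ.imp (lift φ).all)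
  /-- The universe is non-empty. -/
  | nonempty {n : ℕ} :
      LogicalAxiom (BoundedFormula.not (BoundedFormula.all (BoundedFormula.falsum : Fm L (n + 1))))
  | eq_refl {n : ℕ} (t : Tm L n) : LogicalAxiom (BoundedFormula.equal t t)
  | eq_subst {n : ℕ} (φ : Fm L (n + 1)) (s t : Tm L n) :
      LogicalAxiom ((BoundedFormula.equal s t).imp ((inst φ s).imp (inst φ t)))

/-- `Provable T φ` : the sentence `φ` is provable from the set of sentences `T`. -/
inductive Provable (T : Set L.Sentence) : L.Sentence → Prop
  | hyp {φ : L.Sentence} : φ ∈ T → Provable T φ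
  | logical {n : ℕ} {φ : Fm L n} : LogicalAxiom φ → Provable T φ.alls
  | mp {φ ψ : L.Sentence} : Provable T (BoundedFormula.imp φ ψ) → Provable T φ → Provable T ψ

/-- `T` is consistent. -/
def Consistent (T : Set L.Sentence) : Prop := ¬ Provable T (BoundedFormula.falsum : Fm L 0)

/-- `T` is a theory, i.e. is equal to the set of sentences that are provable in it. -/
def IsTheory (T : Set L.Sentence) : Prop := {φ | Provable T φ} = T

/-! ### Gödel numberings -/

section Coding

variable [Encodable (Σ n, L.Functions n)] [Encodable (Σ n, L.Relations n)]

/-- The standard code of a term. -/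
def tmCode {n : ℕ} : Tm L n → ℕ
  | .var (Sum.inl e) => Empty.elim e
  | .var (Sum.inr i) => Nat.pair 0 i
  | .func (l := l) f ts =>
      Nat.pair (Encodable.encode (⟨l, f⟩ : Σ n, L.Functions n) + 1)
        (Encodable.encode (List.ofFn fun i => tmCode (ts i)))

/-- The standard code of a formula. -/
def fmCode : ∀ {n : ℕ}, Fm L n → ℕ
  | _, .falsum => Nat.pair 0 0
  | _, .equal t s => Nat.pair 1 (Nat.pair (tmCode t) (tmCode s))
  | _, .rel (l := l) R ts =>
      Nat.pair 2 (Nat.pair (Encodable.encode (⟨l, R⟩ : Σ n, L.Relations n))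
        (Encodable.encode (List.ofFn fun i => tmCode (ts i))))
  | _, .imp φ ψ => Nat.pair 3 (Nat.pair (fmCode φ) (fmCode ψ))
  | _, .all φ => Nat.pair 4 (fmCode φ)

/-- `g` is a Gödel numbering of the sentences: distinct sentences have distinct numbers, and
there are algorithms that compute the number of a sentence from the sentence, as given by its
standard code, and the sentence from its number. -/
def IsGoedelNumbering (g : L.Sentence → ℕ) : Prop :=
  Function.Injective g ∧
    (∃ p : ℕ →. ℕ, Partrec p ∧ ∀ φ : L.Sentence, g φ ∈ p (fmCode φ)) ∧
    (∃ q : ℕ →. ℕ, Partrec q ∧ ∀ φ : L.Sentence, fmCode φ ∈ q (g φ))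

end Coding

/-! ### Effectively inseparable theories -/

/-- The set of Gödel numbers of the sentences provable in `T`. -/
def provableNumbers (g : L.Sentence → ℕ) (T : Set L.Sentence) : Set ℕ :=
  g '' {φ | Provable T φ}

/-- The set of Gödel numbers of the sentences refutable in `T`. -/
def refutableNumbers (g : L.Sentence → ℕ) (T : Set L.Sentence) : Set ℕ :=
  g '' {φ | Provable T (BoundedFormula.not φ)}

/-- `X` is (the set of Gödel numbers of the elements of) a consistent theory whose pair of nuclei is
effectively inseparable. -/
def IsEITheory (g : L.Sentence → ℕ) (X : Set ℕ) : Prop :=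
  ∃ T : Set L.Sentence, g '' T = X ∧ IsTheory T ∧ Consistent T ∧
    EffectivelyInseparable (provableNumbers g T) (refutableNumbers g T)

end EITheory

/-!
Read literally, the definition of effective inseparability of `(A, B)` is `Σ⁰₄`, because the hypotheses
`A ⊆ W i` and `B ⊆ W j` are `Π⁰₂`.  They can be removed: by the `s-m-n` theorem it suffices to
require `f i j ∉ A ∪ W i ∪ B ∪ W j` whenever `A ∪ W i` and `B ∪ W j` are disjoint.  For recursively
enumerable `A` and `B`, this requirement is an implication from a `Π⁰₁` to a `Π⁰₁` condition, and
hence `Π⁰₂` when it is quantified over all `i` and `j`.  Since totality of `f` is `Π⁰₂` as well, effective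
inseparability is `Σ⁰₃` (`effectivelyInseparable_iff`), uniformly in indices of `A` and `B`.

The remaining requirements on `W e` are `Π⁰₂`: it consists of Gödel numbers, contains the numbers of
the logical axioms, is closed under modus ponens, and does not contain the number of `⊥`
(`isEITheory_iff`).  In this case `A` is `W e`, and `B` consists of the numbers of the sentences
whose negations have numbers in `W e`.

What has to be shown about the syntax is that the set of numbers of logical axioms is recursively
enumerable (`rePred_axiom_number`), and for this that substitution is recursively enumerable on
standard codes (`exists_rePred_substitution`).  Its graph is defined by recursion on codes.  That
such a recursion, with parameters that vary from one call to the next, defines a recursively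
enumerable predicate follows from Kleene's recursion theorem (`exists_rePred_fixed_point`); that the
predicate has the intended meaning follows by induction on codes and on formulas.
-/

namespace EITheory

open FirstOrder.Language (Term BoundedFormula)

/-! ### Recursively enumerable predicates -/

section Enumerable

open Nat.Partrec (Code)
open Encodable (encode decode)

variable {α β γ : Type*} [Primcodable α] [Primcodable β] [Primcodable γ]

-- Below, the closure properties of `Computable` are put in the shape in which `fun_prop` uses them.
-- Decoding with `Nat.unpair` is registered as a whole: a rule for its first component would be
-- tried on every projection.
attribute [fun_prop] Computable

@[fun_prop] theorem computable_id' : Computable fun a : α => a := Computable.id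

@[fun_prop] theorem computable_const' (b : β) : Computable fun _ : α => b := Computable.const b

@[fun_prop] theorem computable_comp' {f : β → γ} {g : α → β} (hf : Computable f)
    (hg : Computable g) : Computable fun a => f (g a) := hf.comp hg

@[fun_prop] theorem computable_fst' {f : α → β × γ} (hf : Computable f) :
    Computable fun a => (f a).1 := Computable.fst.comp hf

@[fun_prop] theorem computable_snd' {f : α → β × γ} (hf : Computable f) :
    Computable fun a => (f a).2 := Computable.snd.comp hf

@[fun_prop] theorem computable_pair' {f : α → β} {g : α → γ} (hf : Computable f)
    (hg : Computable g) : Computable fun a => (f a, g a) := hf.pair hg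

@[fun_prop] theorem computable_some' {f : α → β} (hf : Computable f) :
    Computable fun a => some (f a) := Computable.option_some.comp hf

@[fun_prop] theorem computable_encode' {f : α → β} (hf : Computable f) :
    Computable fun a => encode (f a) := Computable.encode.comp hf

@[fun_prop] theorem computable_natPair {f g : α → ℕ} (hf : Computable f) (hg : Computable g) :
    Computable fun a => Nat.pair (f a) (g a) := Primrec₂.natPair.to_comp.comp hf hg

@[fun_prop] theorem computable_unpair {f : α → ℕ} (hf : Computable f) :
    Computable fun a => (f a).unpair := Primrec.unpair.to_comp.comp hf

@[fun_prop] theorem computable_add {f g : α → ℕ} (hf : Computable f) (hg : Computable g) :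
    Computable fun a => f a + g a := Primrec.nat_add.to_comp.comp hf hg

@[fun_prop] theorem computable_append {f g : α → List ℕ} (hf : Computable f)
    (hg : Computable g) : Computable fun a => f a ++ g a := Primrec.list_append.to_comp.comp hf hg

@[fun_prop] theorem computable_cons {f : α → ℕ} {g : α → List ℕ} (hf : Computable f)
    (hg : Computable g) : Computable fun a => f a :: g a := Primrec.list_cons.to_comp.comp hf hg

@[fun_prop] theorem computable_getElem? {f : α → List ℕ} {g : α → ℕ} (hf : Computable f)
    (hg : Computable g) : Computable fun a => (f a)[g a]? :=
  Primrec.list_getElem?.to_comp.comp hf hg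

@[fun_prop] theorem computable_evaln {f g h : α → ℕ} (hf : Computable f) (hg : Computable g)
    (hh : Computable h) :
    Computable fun a => (Denumerable.ofNat Code (f a)).evaln (g a) (h a) :=
  Code.primrec_evaln.to_comp.comp
    ((hg.pair ((Computable.ofNat Code).comp hf)).pair hh)

/-- A predicate is recursively enumerable if and only if it is the projection of a decidable
relation.  The number `n` bounds the length of the computation. -/
theorem rePred_iff_exists_bool {p : α → Prop} :
    REPred p ↔ ∃ R : α → ℕ → Bool, Computable₂ R ∧ ∀ a, p a ↔ ∃ n, R a n = true := by
  constructor
  · intro hp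
    obtain ⟨c, hc⟩ := Code.exists_code.1 hp
    refine ⟨fun a n => (c.evaln n (encode a)).isSome, ?_, fun a => ?_⟩
    · exact Primrec.option_isSome.to_comp.comp (Code.primrec_evaln.to_comp.comp
        ((Computable.snd.pair (Computable.const c)).pair (Computable.encode.comp Computable.fst)))
    · have h : p a ↔ (c.eval (encode a)).Dom := by
        rw [hc]; simp [Part.assert]
      simp only [h, Part.dom_iff_mem, Code.evaln_complete, Option.isSome_iff_exists, Option.mem_def]
      exact exists_comm
  · rintro ⟨R, hR, h⟩
    refine (Partrec.rfind hR.partrec₂).dom_re.of_eq fun a => ?_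
    rw [h]
    simp [Nat.rfind_dom]

/-- Recursively enumerable predicates are closed under computable substitution. -/
theorem _root_.REPred.comp {p : β → Prop} {f : α → β} (hp : REPred p) (hf : Computable f) :
    REPred fun a => p (f a) :=
  Partrec.comp hp hf

theorem _root_.REPred.and {p q : α → Prop} (hp : REPred p) (hq : REPred q) :
    REPred fun a => p a ∧ q a := by
  obtain ⟨R, hR, hp⟩ := rePred_iff_exists_bool.1 hp
  obtain ⟨S, hS, hq⟩ := rePred_iff_exists_bool.1 hq
  refine rePred_iff_exists_bool.2 ⟨fun a n => R a n.unpair.1 && S a n.unpair.2, ?_, fun a => ?_⟩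
  · exact Primrec.and.to_comp.comp (hR.comp (by fun_prop) (by fun_prop))
      (hS.comp (by fun_prop) (by fun_prop))
  · simp only [hp, hq, Bool.and_eq_true]
    exact ⟨fun ⟨⟨m, hm⟩, n, hn⟩ => ⟨Nat.pair m n, by simpa using ⟨hm, hn⟩⟩,
      fun ⟨n, h⟩ => ⟨⟨_, h.1⟩, _, h.2⟩⟩

theorem _root_.REPred.or {p q : α → Prop} (hp : REPred p) (hq : REPred q) :
    REPred fun a => p a ∨ q a := by
  obtain ⟨R, hR, hp⟩ := rePred_iff_exists_bool.1 hp
  obtain ⟨S, hS, hq⟩ := rePred_iff_exists_bool.1 hq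
  refine rePred_iff_exists_bool.2 ⟨fun a n => R a n || S a n, ?_, fun a => ?_⟩
  · exact Primrec.or.to_comp.comp hR hS
  · simp only [hp, hq, Bool.or_eq_true, exists_or]

theorem _root_.REPred.exists {p : α → β → Prop} (hp : REPred fun x : α × β => p x.1 x.2) :
    REPred fun a => ∃ b, p a b := by
  obtain ⟨R, hR, hp⟩ := rePred_iff_exists_bool.1 hp
  -- The two components of `n` encode the witness and bound the length of the computation.
  refine rePred_iff_exists_bool.2 ⟨fun a n =>
    ((decode (α := β) n.unpair.1).map fun b => R (a, b) n.unpair.2).getD false, ?_, fun a => ?_⟩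
  · refine Computable.option_getD (Computable.option_map (Computable.decode.comp (by fun_prop)) ?_)
      (Computable.const false)
    exact hR.comp (by fun_prop) (by fun_prop)
  · constructor
    · rintro ⟨b, hb⟩
      obtain ⟨n, hn⟩ := (hp (a, b)).1 hb
      exact ⟨Nat.pair (encode b) n, by simpa using hn⟩
    · rintro ⟨n, hn⟩
      cases hd : decode (α := β) n.unpair.1 with
      | none => simp [hd] at hn
      | some b => exact ⟨b, (hp (a, b)).2 ⟨_, by simpa [hd] using hn⟩⟩

theorem rePred_eq {f g : α → β} (hf : Computable f) (hg : Computable g) :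
    REPred fun a => f a = g a := by
  classical
  have : ComputablePred fun x : β × β => x.1 = x.2 :=
    (PrimrecRel.comp Primrec.eq Primrec.fst Primrec.snd).computablePred
  exact this.to_re.comp (hf.pair hg)

theorem rePred_const (p : Prop) : REPred fun _ : α => p := by
  classical
  exact (rePred_eq (Computable.const (decide p)) (Computable.const true)).of_eq (by simp)

theorem rePred_mem_eval {f g h : α → ℕ} (hf : Computable f) (hg : Computable g)
    (hh : Computable h) : REPred fun a => h a ∈ (Denumerable.ofNat Code (f a)).eval (g a) := by
  simp only [Code.evaln_complete, Option.mem_def]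
  exact .exists (rePred_eq (by fun_prop) (by fun_prop))

theorem rePred_mem_partrec {p : ℕ →. ℕ} (hp : Partrec p) {f g : α → ℕ} (hf : Computable f)
    (hg : Computable g) : REPred fun a => g a ∈ p (f a) := by
  obtain ⟨c, rfl⟩ := Code.exists_code.1 (Partrec.nat_iff.1 hp)
  simpa using rePred_mem_eval (computable_const' (encode c)) hf hg

theorem rePred_mem_W {f g : α → ℕ} (hf : Computable f) (hg : Computable g) :
    REPred fun a => g a ∈ W (f a) := by
  simp only [W, Set.mem_ofPred_eq, Part.dom_iff_mem]
  exact .exists (rePred_mem_eval (by fun_prop) (by fun_prop) (by fun_prop))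

/-- The `s-m-n` theorem for recursively enumerable sets. -/
theorem exists_computable_index {p : α → ℕ → Prop} (hp : REPred fun x : α × ℕ => p x.1 x.2) :
    ∃ s : α → ℕ, Computable s ∧ ∀ a x, x ∈ W (s a) ↔ p a x := by
  obtain ⟨c, hc⟩ := Code.exists_code.1 hp
  refine ⟨fun a => encode (c.curry (encode a)), ?_, fun a x => ?_⟩
  · exact Computable.encode.comp (Code.primrec₂_curry.to_comp.comp (Computable.const c)
      Computable.encode)
  · have : Nat.pair (encode a) x = encode (a, x) := by simp
    simp only [W, Set.mem_ofPred_eq, Denumerable.ofNat_encode, Code.eval_curry, hc]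
    rw [this, Encodable.encodek]
    simp [Part.assert]

/-- A predicate may be defined by recursion if the recursion clause `Φ` is recursively enumerable,
uniformly in an index of the predicate to which it is applied.  This is a form of Kleene's second
recursion theorem. -/
theorem exists_rePred_fixed_point {Φ : (α → Prop) → α → Prop}
    (hΦ : REPred fun x : ℕ × α => Φ (fun y => encode y ∈ W x.1) x.2) :
    ∃ P : α → Prop, REPred P ∧ ∀ x, P x ↔ Φ P x := by
  obtain ⟨s, hs, h⟩ := exists_computable_index
    (p := fun (e : ℕ) (n : ℕ) => ∃ y : α, encode y = n ∧ Φ (fun y => encode y ∈ W e) y)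
    (.exists (.and (rePred_eq (by fun_prop) (by fun_prop))
      (hΦ.comp (f := fun x : (ℕ × ℕ) × α => (x.1.1, x.2)) (by fun_prop))))
  obtain ⟨c, hc⟩ := Code.fixed_point (f := fun c => Denumerable.ofNat Code (s (encode c)))
    ((Computable.ofNat Code).comp (hs.comp Computable.encode))
  refine ⟨fun y => encode y ∈ W (encode c), rePred_mem_W (by fun_prop) (by fun_prop), fun x => ?_⟩
  have hW : W (encode c) = W (s (encode c)) := by simp [W, hc]
  refine ⟨fun hx => ?_, fun hx => ?_⟩
  · rw [hW] at hx
    obtain ⟨y, hy, hy'⟩ := (h _ _).1 hx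
    obtain rfl := Encodable.encode_injective hy
    exact hy'
  · rw [hW]
    exact (h _ _).2 ⟨x, rfl, hx⟩

end Enumerable

/-! ### The second and third levels of the arithmetical hierarchy -/

section Hierarchy

variable {α : Type*} [Primcodable α]

/-- `p` is a `Π⁰₂` predicate: a universal number quantifier in front of a recursively enumerable
predicate. -/
def IsPi2 (p : α → Prop) : Prop :=
  ∃ q : α → ℕ → Prop, REPred (fun x : α × ℕ => q x.1 x.2) ∧ ∀ a, p a ↔ ∀ n, q a n

theorem IsPi2.of_eq {p q : α → Prop} (hp : IsPi2 p) (h : ∀ a, p a ↔ q a) : IsPi2 q :=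
  (funext fun a => propext (h a) : p = q) ▸ hp

theorem _root_.REPred.isPi2 {p : α → Prop} (hp : REPred p) : IsPi2 p :=
  ⟨fun a _ => p a, hp.comp Computable.fst, fun _ => by simp⟩

theorem _root_.REPred.isPi2_not {p : α → Prop} (hp : REPred p) : IsPi2 fun a => ¬ p a := by
  obtain ⟨R, hR, h⟩ := rePred_iff_exists_bool.1 hp
  refine ⟨fun a n => R a n = false, rePred_eq hR (by fun_prop), fun a => ?_⟩
  simp [h]

theorem IsPi2.forall_nat {p : α → ℕ → Prop} (hp : IsPi2 fun x : α × ℕ => p x.1 x.2) :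
    IsPi2 fun a => ∀ n, p a n := by
  obtain ⟨q, hq, h⟩ := hp
  refine ⟨fun a k => q (a, k.unpair.1) k.unpair.2,
    hq.comp (f := fun x : α × ℕ => ((x.1, x.2.unpair.1), x.2.unpair.2)) (by fun_prop), fun a => ?_⟩
  exact ⟨fun H k => (h (a, _)).1 (H _) _,
    fun H n => (h (a, n)).2 fun m => by simpa using H (Nat.pair n m)⟩

theorem IsPi2.and {p q : α → Prop} (hp : IsPi2 p) (hq : IsPi2 q) : IsPi2 fun a => p a ∧ q a := by
  obtain ⟨p', hp', h⟩ := hp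
  obtain ⟨q', hq', h'⟩ := hq
  exact ⟨fun a n => p' a n ∧ q' a n, hp'.and hq', fun a => by simp only [h, h', forall_and]⟩

theorem IsPi2.or {p q : α → Prop} (hp : IsPi2 p) (hq : IsPi2 q) : IsPi2 fun a => p a ∨ q a := by
  obtain ⟨p', hp', h⟩ := hp
  obtain ⟨q', hq', h'⟩ := hq
  refine ⟨fun a k => p' a k.unpair.1 ∨ q' a k.unpair.2,
    (hp'.comp (f := fun x : α × ℕ => (x.1, x.2.unpair.1)) (by fun_prop)).or
      (hq'.comp (f := fun x : α × ℕ => (x.1, x.2.unpair.2)) (by fun_prop)), fun a => ?_⟩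
  simp only [h, h']
  refine ⟨fun H k => H.imp (fun H => H _) fun H => H _, fun H => ?_⟩
  by_contra! hc
  obtain ⟨⟨m, hm⟩, n, hn⟩ := hc
  simpa [hm, hn] using H (Nat.pair m n)

theorem IsPi2.imp_of_rePred {p q : α → Prop} (hp : REPred p) (hq : IsPi2 q) :
    IsPi2 fun a => p a → q a :=
  (hp.isPi2_not.or hq).of_eq fun _ => imp_iff_not_or.symm

theorem IsPi2.comp {β : Type*} [Primcodable β] {p : β → Prop} {f : α → β} (hp : IsPi2 p)
    (hf : Computable f) : IsPi2 fun a => p (f a) := by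
  obtain ⟨q, hq, h⟩ := hp
  exact ⟨fun a n => q (f a) n, hq.comp (f := fun x : α × ℕ => (f x.1, x.2)) (by fun_prop),
    fun a => h _⟩

theorem isSigma_one_of_rePred {A : Set ℕ} (hA : REPred fun x => x ∈ A) : IsSigma 1 A := by
  obtain ⟨R, hR, h⟩ := rePred_iff_exists_bool.1 hA
  refine ⟨{z | R z.unpair.1 z.unpair.2 = true}, ?_, ?_⟩
  · have : Computable fun z : ℕ => R z.unpair.1 z.unpair.2 := hR.comp (by fun_prop) (by fun_prop)
    exact ComputablePred.not (ComputablePred.computable_iff.2 ⟨_, this, rfl⟩)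
  · ext x
    simp [h]

theorem isSigma_two_of_isPi2_compl {A : Set ℕ} (hA : IsPi2 fun x => x ∉ A) : IsSigma 2 A := by
  obtain ⟨q, hq, h⟩ := hA
  refine ⟨{z | ¬ q z.unpair.1 z.unpair.2}, isSigma_one_of_rePred ?_, ?_⟩
  · exact (hq.comp (f := fun z : ℕ => (z.unpair.1, z.unpair.2)) (by fun_prop)).of_eq (by simp)
  · ext x
    simpa using not_congr (h x)

theorem isSigma_three_of_exists_isPi2 {p : ℕ → ℕ → Prop}
    (hp : IsPi2 fun x : ℕ × ℕ => p x.1 x.2) : IsSigma 3 {e | ∃ k, p e k} := by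
  refine ⟨{z | p z.unpair.1 z.unpair.2}, isSigma_two_of_isPi2_compl ?_, by simp⟩
  exact (hp.comp (f := fun z : ℕ => (z.unpair.1, z.unpair.2)) (by fun_prop)).of_eq (by simp)

end Hierarchy

/-! ### Substitution on codes -/

section SubstitutionCodes

open Encodable (encode)

theorem rePred_mem_finite {α β : Type*} [Primcodable α] [Primcodable β] {S : Set β}
    (hS : S.Finite) {f : α → β} (hf : Computable f) : REPred fun a => f a ∈ S := by
  induction S, hS using Set.Finite.induction_on with
  | empty => exact (rePred_const False).of_eq (by simp)
  | insert _ _ ih => exact (rePred_eq hf (computable_const' _)).or ih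

theorem alls_injective {L : FirstOrder.Language.{u, v}} : ∀ {n : ℕ},
    Function.Injective (BoundedFormula.alls : Fm L n → L.Sentence)
  | 0, _, _, h => h
  | n + 1, φ, ψ, h => by
    have := alls_injective (n := n) (a₁ := φ.all) (a₂ := ψ.all) h
    simpa using this

variable (L : FirstOrder.Language.{u, v})

section Terms

variable [Encodable (Σ n, L.Functions n)]

/-- The pairs of the code and the arity of a function symbol. -/
def functionTable : Set (ℕ × ℕ) :=
  Set.range fun f : Σ n, L.Functions n => (encode f, f.1)

theorem finite_functionTable [Finite L.Symbols] : (functionTable L).Finite :=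
  have : Finite (Σ n, L.Functions n) :=
    Finite.of_injective (Sum.inl : _ → L.Symbols) Sum.inl_injective
  Set.finite_range _

/-- The recursion clause for substitution in (lists of) codes of terms.  In `(σ, m, c, d)`, the list
`σ` consists of the codes of the terms put for the variables, and `d` is the code of the result of
the substitution in `c`, where `c` is the code of a term if `m = 0` and of a list of `l` terms if
`m = l + 1`.  The look-up in `σ` fails unless the variables of `c` are among the first `σ.length`,
so the clause also checks that `c` is a code. -/
def TermClause (P : List ℕ × ℕ × ℕ × ℕ → Prop) : List ℕ × ℕ × ℕ × ℕ → Prop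
  | (σ, m, c, d) =>
    (∃ i, m = 0 ∧ c = Nat.pair 0 i ∧ σ[i]? = some d) ∨
    (∃ k l a b, m = 0 ∧ (k, l) ∈ functionTable L ∧ c = Nat.pair (k + 1) a ∧
      d = Nat.pair (k + 1) b ∧ P (σ, l + 1, a, b)) ∨
    (m = 1 ∧ c = 0 ∧ d = 0) ∨
    (∃ l a b a' b', m = l + 2 ∧ c = Nat.pair a b + 1 ∧ d = Nat.pair a' b' + 1 ∧
      P (σ, 0, a, a') ∧ P (σ, l + 1, b, b'))

theorem exists_rePred_termClause [Finite L.Symbols] :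
    ∃ T : List ℕ × ℕ × ℕ × ℕ → Prop, REPred T ∧ ∀ x, T x ↔ TermClause L T x := by
  apply exists_rePred_fixed_point
  simp only [TermClause]
  repeat' first
    | with_reducible apply REPred.or
    | with_reducible apply REPred.exists
    | with_reducible apply REPred.and
    | with_reducible refine rePred_mem_W (by fun_prop) (by fun_prop)
    | with_reducible refine rePred_eq (by fun_prop) (by fun_prop)
    | with_reducible refine rePred_mem_finite (finite_functionTable L) (by fun_prop)

variable {L}

/-- A predicate that satisfies the recursion clause for terms holds only of actual substitutions:
the clause refers to smaller codes only. -/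
theorem term_code_of_termClause {T : List ℕ × ℕ × ℕ × ℕ → Prop}
    (hT : ∀ x, T x ↔ TermClause L T x) {m n : ℕ} (s : Fin m → Tm L n) (c : ℕ) :
    (∀ d, T (List.ofFn fun i => tmCode (s i), 0, c, d) →
      ∃ t : Tm L m, tmCode t = c ∧ tmCode (tsub t s) = d) ∧
    ∀ l d, T (List.ofFn fun i => tmCode (s i), l + 1, c, d) →
      ∃ ts : Fin l → Tm L m, encode (List.ofFn fun i => tmCode (ts i)) = c ∧
        encode (List.ofFn fun i => tmCode (tsub (ts i) s)) = d := by
  induction c using Nat.strong_induction_on with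
  | _ c ih =>
  refine ⟨fun d h => ?_, fun l d h => ?_⟩
  · rw [hT] at h
    rcases h with ⟨i, -, rfl, hi⟩ | ⟨k, l, a, b, -, ⟨⟨l, f⟩, hf⟩, rfl, rfl, h⟩ | ⟨h, -⟩ |
      ⟨l, a, b, a', b', h, -⟩
    · obtain ⟨hi, rfl⟩ := List.getElem?_eq_some_iff.1 hi
      have hi' : i < m := by simpa using hi
      exact ⟨bvar ⟨i, hi'⟩, by simp [bvar, tmCode], by simp [bvar, tsub, Term.subst]⟩
    · cases hf
      have ha : a < Nat.pair (encode (⟨l, f⟩ : Σ n, L.Functions n) + 1) a := by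
        have := Nat.add_le_pair (encode (⟨l, f⟩ : Σ n, L.Functions n) + 1) a
        omega
      obtain ⟨ts, rfl, rfl⟩ := (ih a ha).2 _ _ h
      exact ⟨.func f ts, by simp [tmCode], by simp [tmCode, tsub, Term.subst]⟩
    · omega
    · omega
  · rw [hT] at h
    rcases h with ⟨i, h, -⟩ | ⟨k, l, a, b, h, -⟩ | ⟨h, rfl, rfl⟩ |
      ⟨l, a, b, a', b', h, rfl, rfl, h₁, h₂⟩
    · omega
    · omega
    · obtain rfl : l = 0 := by omega
      exact ⟨Fin.elim0, by simp, by simp⟩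
    · obtain rfl : _ = l + 1 := Nat.succ_injective h
      obtain ⟨t, rfl, rfl⟩ := (ih a (Nat.lt_succ_of_le (Nat.left_le_pair _ _))).1 _ h₁
      obtain ⟨ts, rfl, rfl⟩ := (ih b (Nat.lt_succ_of_le (Nat.right_le_pair _ _))).2 _ _ h₂
      exact ⟨Fin.cons t ts, by simp, by simp⟩

theorem termClause_list {T : List ℕ × ℕ × ℕ × ℕ → Prop}
    (hT : ∀ x, T x ↔ TermClause L T x) (σ : List ℕ) {l : ℕ} (f g : Fin l → ℕ)
    (h : ∀ i, T (σ, 0, f i, g i)) : T (σ, l + 1, encode (List.ofFn f), encode (List.ofFn g)) := by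
  induction l with
  | zero => exact (hT _).2 (.inr <| .inr <| .inl <| by simp)
  | succ l ih =>
    refine (hT _).2 (.inr <| .inr <| .inr ⟨l, f 0, _, g 0, _, rfl, ?_, ?_, h 0,
      ih (fun i => f i.succ) (fun i => g i.succ) fun i => h i.succ⟩) <;> simp [List.ofFn_succ]

/-- A predicate that satisfies the recursion clause for terms holds of all substitutions. -/
theorem termClause_term_code {T : List ℕ × ℕ × ℕ × ℕ → Prop}
    (hT : ∀ x, T x ↔ TermClause L T x) {m n : ℕ} (s : Fin m → Tm L n) (t : Tm L m) :
    T (List.ofFn fun i => tmCode (s i), 0, tmCode t, tmCode (tsub t s)) := by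
  induction t with
  | var x =>
    rcases x with e | i
    · exact e.elim
    · exact (hT _).2 (.inl ⟨i, rfl, by simp [tmCode], by simp [tsub, Term.subst]⟩)
  | func f ts ih =>
    refine (hT _).2 (.inr <| .inl ⟨_, _, _, _, rfl, ⟨⟨_, f⟩, rfl⟩, ?_, ?_,
      termClause_list hT _ _ _ ih⟩)
    · simp [tmCode]
    · simp [tmCode, tsub, Term.subst]

theorem tmCode_tsub_castSucc {n : ℕ} (t : Tm L n) :
    tmCode (tsub t fun k => bvar k.castSucc) = tmCode t := by
  induction t with
  | var x =>
    rcases x with e | i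
    · exact e.elim
    · simp [tsub, Term.subst, bvar, tmCode]
  | func f ts ih =>
    simp only [tsub] at ih
    simp [tsub, Term.subst, tmCode, ih]

theorem ofFn_tmCode_snoc {m n : ℕ} (s : Fin m → Tm L n) (t : Tm L n) :
    List.ofFn (fun i => tmCode (Fin.snoc (α := fun _ : Fin (m + 1) => Tm L n) s t i)) =
      List.ofFn (fun i => tmCode (s i)) ++ [tmCode t] := by
  rw [List.ofFn_succ']
  simp

theorem ofFn_tmCode_snoc_bvar {m n : ℕ} (s : Fin m → Tm L n) :
    List.ofFn (fun i => tmCode (Fin.snoc (α := fun _ : Fin (m + 1) => Tm L (n + 1))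
        (fun i => tsub (s i) fun k => bvar k.castSucc) (bvar (Fin.last n)) i)) =
      List.ofFn (fun i => tmCode (s i)) ++ [Nat.pair 0 n] := by
  rw [ofFn_tmCode_snoc]
  simp only [tmCode_tsub_castSucc]
  simp [bvar, tmCode]

/-- The codes of the variables `0, …, n - 1`. -/
def variableCodes (n : ℕ) : List ℕ := (List.range n).map (Nat.pair 0)

@[fun_prop] theorem computable_variableCodes {α : Type*} [Primcodable α] {f : α → ℕ}
    (hf : Computable f) : Computable fun a => variableCodes (f a) :=
  (Primrec.list_map Primrec.list_range
    (Primrec₂.natPair.comp (Primrec.const 0) Primrec.snd).to₂).to_comp.comp hf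

theorem variableCodes_eq_ofFn {m n : ℕ} (x : Fin m → Fin n) (hx : ∀ i, (x i : ℕ) = i) :
    variableCodes m = List.ofFn fun i => tmCode (bvar (x i) : Tm L n) := by
  apply List.ext_getElem <;> simp [variableCodes, tmCode, bvar, hx]

end Terms

section Formulas

variable [Encodable (Σ n, L.Relations n)]

/-- The pairs of the code and the arity of a relation symbol. -/
def relationTable : Set (ℕ × ℕ) :=
  Set.range fun R : Σ n, L.Relations n => (encode R, R.1)

theorem finite_relationTable [Finite L.Symbols] : (relationTable L).Finite :=
  have : Finite (Σ n, L.Relations n) :=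
    Finite.of_injective (Sum.inr : _ → L.Symbols) Sum.inr_injective
  Set.finite_range _

/-- The recursion clause for substitution in codes of formulas, given the predicate `T` for
substitution in terms.  In `(σ, n, c, d)`, the codes in `σ` are those of terms in the variables
`0, …, n - 1`, and `d` is the code of the result of the substitution in the formula coded by `c`.
Weakening a term to one more variable does not change its code, so that under a quantifier `σ` is
only extended by the code of the new bound variable. -/
def FormulaClause (T P : List ℕ × ℕ × ℕ × ℕ → Prop) : List ℕ × ℕ × ℕ × ℕ → Prop
  | (σ, n, c, d) =>
    (c = Nat.pair 0 0 ∧ d = Nat.pair 0 0) ∨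
    (∃ a b a' b', c = Nat.pair 1 (Nat.pair a b) ∧ d = Nat.pair 1 (Nat.pair a' b') ∧
      T (σ, 0, a, a') ∧ T (σ, 0, b, b')) ∨
    (∃ k l a b, (k, l) ∈ relationTable L ∧ c = Nat.pair 2 (Nat.pair k a) ∧
      d = Nat.pair 2 (Nat.pair k b) ∧ T (σ, l + 1, a, b)) ∨
    (∃ a b a' b', c = Nat.pair 3 (Nat.pair a b) ∧ d = Nat.pair 3 (Nat.pair a' b') ∧
      P (σ, n, a, a') ∧ P (σ, n, b, b')) ∨
    (∃ a a', c = Nat.pair 4 a ∧ d = Nat.pair 4 a' ∧ P (σ ++ [Nat.pair 0 n], n + 1, a, a'))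

theorem exists_rePred_formulaClause [Finite L.Symbols] {T : List ℕ × ℕ × ℕ × ℕ → Prop}
    (hT : REPred T) :
    ∃ P : List ℕ × ℕ × ℕ × ℕ → Prop, REPred P ∧ ∀ x, P x ↔ FormulaClause L T P x := by
  apply exists_rePred_fixed_point
  simp only [FormulaClause]
  repeat' first
    | with_reducible apply REPred.or
    | with_reducible apply REPred.exists
    | with_reducible apply REPred.and
    | with_reducible refine rePred_mem_W (by fun_prop) (by fun_prop)
    | with_reducible refine rePred_eq (by fun_prop) (by fun_prop)
    | with_reducible refine rePred_mem_finite (finite_relationTable L) (by fun_prop)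
    | with_reducible apply REPred.comp hT
  all_goals fun_prop

variable [Encodable (Σ n, L.Functions n)]

variable {L}

/-- A predicate that satisfies the recursion clause for formulas holds only of actual
substitutions. -/
theorem formula_code_of_formulaClause {T P : List ℕ × ℕ × ℕ × ℕ → Prop}
    (hT : ∀ x, T x ↔ TermClause L T x) (hP : ∀ x, P x ↔ FormulaClause L T P x) (c : ℕ) :
    ∀ {m n : ℕ} (s : Fin m → Tm L n) (d : ℕ), P (List.ofFn fun i => tmCode (s i), n, c, d) →
      ∃ φ : Fm L m, fmCode φ = c ∧ fmCode (fsub φ s) = d := by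
  induction c using Nat.strong_induction_on with
  | _ c ih =>
  intro m n s d h
  have lt (k a : ℕ) : a < Nat.pair (k + 1) a := by
    have := Nat.add_le_pair (k + 1) a
    omega
  rw [hP] at h
  rcases h with ⟨rfl, rfl⟩ | ⟨a, b, a', b', rfl, rfl, h₁, h₂⟩ |
    ⟨k, l, a, b, ⟨⟨l, R⟩, hR⟩, rfl, rfl, h⟩ | ⟨a, b, a', b', rfl, rfl, h₁, h₂⟩ |
    ⟨a, a', rfl, rfl, h⟩
  · exact ⟨.falsum, by simp [fmCode], by simp [fmCode, fsub]⟩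
  · obtain ⟨t, rfl, rfl⟩ := (term_code_of_termClause hT s a).1 _ h₁
    obtain ⟨t', rfl, rfl⟩ := (term_code_of_termClause hT s b).1 _ h₂
    exact ⟨.equal t t', by simp [fmCode], by simp [fmCode, fsub]⟩
  · cases hR
    obtain ⟨ts, rfl, rfl⟩ := (term_code_of_termClause hT s a).2 _ _ h
    exact ⟨.rel R ts, by simp [fmCode], by simp [fmCode, fsub]⟩
  · obtain ⟨φ, rfl, rfl⟩ := ih a ((Nat.left_le_pair a b).trans_lt (lt 2 _)) s _ h₁
    obtain ⟨ψ, rfl, rfl⟩ := ih b ((Nat.right_le_pair _ b).trans_lt (lt 2 _)) s _ h₂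
    exact ⟨.imp φ ψ, by simp [fmCode], by simp [fmCode, fsub]⟩
  · rw [← ofFn_tmCode_snoc_bvar] at h
    obtain ⟨φ, rfl, rfl⟩ := ih a (lt 3 _) _ _ h
    exact ⟨.all φ, by simp [fmCode], by simp [fmCode, fsub]⟩

/-- A predicate that satisfies the recursion clause for formulas holds of all substitutions. -/
theorem formulaClause_formula_code {T P : List ℕ × ℕ × ℕ × ℕ → Prop}
    (hT : ∀ x, T x ↔ TermClause L T x) (hP : ∀ x, P x ↔ FormulaClause L T P x)
    {m : ℕ} (φ : Fm L m) : ∀ {n : ℕ} (s : Fin m → Tm L n),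
      P (List.ofFn fun i => tmCode (s i), n, fmCode φ, fmCode (fsub φ s)) := by
  induction φ with
  | falsum => exact fun s => (hP _).2 (.inl <| by simp [fmCode, fsub])
  | equal t t' =>
    exact fun s => (hP _).2 (.inr <| .inl ⟨_, _, _, _, rfl, rfl,
      termClause_term_code hT s t, termClause_term_code hT s t'⟩)
  | rel R ts =>
    exact fun s => (hP _).2 (.inr <| .inr <| .inl ⟨_, _, _, _, ⟨⟨_, R⟩, rfl⟩, by simp [fmCode],
      by simp [fmCode, fsub], termClause_list hT _ _ _ fun i => termClause_term_code hT s (ts i)⟩)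
  | imp φ ψ ih₁ ih₂ =>
    exact fun s => (hP _).2 (.inr <| .inr <| .inr <| .inl ⟨_, _, _, _, rfl,
      rfl, ih₁ s, ih₂ s⟩)
  | all φ ih =>
    refine fun s => (hP _).2 (.inr <| .inr <| .inr <| .inr ⟨_, _, rfl,
      rfl, ?_⟩)
    rw [← ofFn_tmCode_snoc_bvar]
    exact ih _

end Formulas

end SubstitutionCodes

/-! ### Enumerating the logical axioms -/

section Axioms

open Encodable (encode)

variable (L : FirstOrder.Language.{u, v})
variable [Encodable (Σ n, L.Functions n)] [Encodable (Σ n, L.Relations n)]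

/-- The graphs of substitution, in terms and in formulas, are recursively enumerable on codes. -/
theorem exists_rePred_substitution [Finite L.Symbols] :
    ∃ T F : List ℕ × ℕ × ℕ × ℕ → Prop, REPred T ∧ REPred F ∧
      (∀ {m n : ℕ} (s : Fin m → Tm L n) (c d : ℕ),
        T (List.ofFn fun i => tmCode (s i), 0, c, d) ↔
          ∃ t : Tm L m, tmCode t = c ∧ tmCode (tsub t s) = d) ∧
      ∀ {m n : ℕ} (s : Fin m → Tm L n) (c d : ℕ),
        F (List.ofFn fun i => tmCode (s i), n, c, d) ↔
          ∃ φ : Fm L m, fmCode φ = c ∧ fmCode (fsub φ s) = d := by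
  obtain ⟨T, hT, hT'⟩ := exists_rePred_termClause L
  obtain ⟨F, hF, hF'⟩ := exists_rePred_formulaClause L hT
  refine ⟨T, F, hT, hF, fun s c d => ⟨(term_code_of_termClause hT' s c).1 d, ?_⟩,
    fun s c d => ⟨formula_code_of_formulaClause hT' hF' c s d, ?_⟩⟩
  · rintro ⟨t, rfl, rfl⟩
    exact termClause_term_code hT' s t
  · rintro ⟨φ, rfl, rfl⟩
    exact formulaClause_formula_code hT' hF' φ s

/-- `c` is the code of a term in the variables `0, …, n - 1`. -/
def IsTmCode (n c : ℕ) : Prop := ∃ t : Tm L n, tmCode t = c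

/-- `c` is the code of a formula in the variables `0, …, n - 1`. -/
def IsFmCode (n c : ℕ) : Prop := ∃ φ : Fm L n, fmCode φ = c

/-- `d` is the code of `φ(t)`, where `a` is the code of the formula `φ` in the variables `0, …, n`,
and `t` stands for the code of a term in the variables `0, …, n - 1`. -/
def IsInstCode (n a t d : ℕ) : Prop :=
  ∃ (φ : Fm L (n + 1)) (s : Tm L n), fmCode φ = a ∧ tmCode s = t ∧ fmCode (inst φ s) = d

/-- `d` is the code of `lift φ`, where `a` is the code of the formula `φ` in the variables
`0, …, n - 1`. -/
def IsLiftCode (n a d : ℕ) : Prop := ∃ φ : Fm L n, fmCode φ = a ∧ fmCode (lift φ) = d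

section Enumerability

variable {α : Type*} [Primcodable α] [Finite L.Symbols]

theorem rePred_isTmCode {f g : α → ℕ} (hf : Computable f) (hg : Computable g) :
    REPred fun a => IsTmCode L (f a) (g a) := by
  obtain ⟨T, F, hT, -, hT', -⟩ := exists_rePred_substitution L
  refine REPred.of_eq (p := fun a => ∃ d, T (variableCodes (f a), 0, g a, d))
    (.exists (hT.comp (f := fun x : α × ℕ => (variableCodes (f x.1), 0, g x.1, x.2))
      (by fun_prop))) fun a => ?_
  simp only [variableCodes_eq_ofFn (L := L) (id : Fin (f a) → _) fun _ => rfl, hT', IsTmCode]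
  exact ⟨fun ⟨_, t, h, _⟩ => ⟨t, h⟩, fun ⟨t, h⟩ => ⟨_, t, h, rfl⟩⟩

theorem rePred_isFmCode {f g : α → ℕ} (hf : Computable f) (hg : Computable g) :
    REPred fun a => IsFmCode L (f a) (g a) := by
  obtain ⟨T, F, -, hF, -, hF'⟩ := exists_rePred_substitution L
  refine REPred.of_eq (p := fun a => ∃ d, F (variableCodes (f a), f a, g a, d))
    (.exists (hF.comp (f := fun x : α × ℕ => (variableCodes (f x.1), f x.1, g x.1, x.2))
      (by fun_prop))) fun a => ?_
  simp only [variableCodes_eq_ofFn (L := L) (id : Fin (f a) → _) fun _ => rfl, hF', IsFmCode]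
  exact ⟨fun ⟨_, t, h, _⟩ => ⟨t, h⟩, fun ⟨t, h⟩ => ⟨_, t, h, rfl⟩⟩

theorem rePred_isInstCode {f g h k : α → ℕ} (hf : Computable f) (hg : Computable g)
    (hh : Computable h) (hk : Computable k) :
    REPred fun a => IsInstCode L (f a) (g a) (h a) (k a) := by
  obtain ⟨T, F, -, hF, -, hF'⟩ := exists_rePred_substitution L
  refine REPred.of_eq ((rePred_isTmCode L hf hh).and
    (hF.comp (f := fun a => (variableCodes (f a) ++ [h a], f a, g a, k a)) (by fun_prop)))
    fun a => ?_
  have key (s : Tm L (f a)) : F (variableCodes (f a) ++ [tmCode s], f a, g a, k a) ↔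
      ∃ φ : Fm L (f a + 1), fmCode φ = g a ∧ fmCode (inst φ s) = k a := by
    rw [variableCodes_eq_ofFn (L := L) (id : Fin (f a) → _) fun _ => rfl, ← ofFn_tmCode_snoc, hF']
    rfl
  constructor
  · rintro ⟨⟨s, hs⟩, H⟩
    rw [← hs] at H
    obtain ⟨φ, h₁, h₂⟩ := (key s).1 H
    exact ⟨φ, s, h₁, hs, h₂⟩
  · rintro ⟨φ, s, h₁, hs, h₂⟩
    refine ⟨⟨s, hs⟩, ?_⟩
    rw [← hs]
    exact (key s).2 ⟨φ, h₁, h₂⟩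

theorem rePred_isLiftCode {f g h : α → ℕ} (hf : Computable f) (hg : Computable g)
    (hh : Computable h) : REPred fun a => IsLiftCode L (f a) (g a) (h a) := by
  obtain ⟨T, F, -, hF, -, hF'⟩ := exists_rePred_substitution L
  refine (hF.comp (f := fun a => (variableCodes (f a), f a + 1, g a, h a)) (by fun_prop)).of_eq
    fun a => ?_
  rw [variableCodes_eq_ofFn (L := L) (Fin.castSucc : Fin (f a) → _) fun _ => rfl, hF']
  rfl

end Enumerability

/-- The code of an implication, from the codes of its two sides. -/
def impCode (a b : ℕ) : ℕ := Nat.pair 3 (Nat.pair a b)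

/-- The code of a negation; `Nat.pair 0 0` is the code of `⊥`. -/
def notCode (a : ℕ) : ℕ := impCode a (Nat.pair 0 0)

/-- The code of a universal quantification. -/
def allCode (a : ℕ) : ℕ := Nat.pair 4 a

/-- The code of an equation, from the codes of its two sides. -/
def eqCode (s t : ℕ) : ℕ := Nat.pair 1 (Nat.pair s t)

section Computability

variable {α : Type*} [Primcodable α]

@[fun_prop] theorem computable_impCode {f g : α → ℕ} (hf : Computable f) (hg : Computable g) :
    Computable fun a => impCode (f a) (g a) := by
  unfold impCode; fun_prop

@[fun_prop] theorem computable_notCode {f : α → ℕ} (hf : Computable f) :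
    Computable fun a => notCode (f a) := by
  unfold notCode; fun_prop

@[fun_prop] theorem computable_allCode {f : α → ℕ} (hf : Computable f) :
    Computable fun a => allCode (f a) := by
  unfold allCode; fun_prop

@[fun_prop] theorem computable_eqCode {f g : α → ℕ} (hf : Computable f) (hg : Computable g) :
    Computable fun a => eqCode (f a) (g a) := by
  unfold eqCode; fun_prop

@[fun_prop] theorem computable_allCode_iterate {f g : α → ℕ} (hf : Computable f)
    (hg : Computable g) : Computable fun a => allCode^[f a] (g a) := by
  have : Primrec₂ fun n a : ℕ => allCode^[n] a :=
    Primrec.nat_iterate Primrec.fst Primrec.snd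
      (Primrec₂.natPair.comp (Primrec.const 4) Primrec.snd)
  exact this.to_comp.comp hf hg

end Computability

section Codes

variable {L} {n : ℕ}

theorem fmCode_imp (φ ψ : Fm L n) :
    fmCode (BoundedFormula.imp φ ψ) = impCode (fmCode φ) (fmCode ψ) := by
  simp [fmCode, impCode]

theorem fmCode_not (φ : Fm L n) : fmCode (BoundedFormula.not φ) = notCode (fmCode φ) :=
  fmCode_imp φ .falsum

theorem fmCode_all (φ : Fm L (n + 1)) : fmCode (BoundedFormula.all φ) = allCode (fmCode φ) := by
  simp [fmCode, allCode]

theorem fmCode_equal (s t : Tm L n) :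
    fmCode (BoundedFormula.equal s t : Fm L n) = eqCode (tmCode s) (tmCode t) := by
  simp [fmCode, eqCode]

theorem fmCode_alls : ∀ {n : ℕ} (φ : Fm L n),
    fmCode (φ.alls : Fm L 0) = allCode^[n] (fmCode φ)
  | 0, _ => rfl
  | n + 1, φ => by
    rw [BoundedFormula.alls, fmCode_alls φ.all, fmCode_all, Function.iterate_succ_apply]

/-- The standard code is injective, since the injective Gödel number of the universal closure can be
computed from it. -/
theorem fmCode_injective {g : L.Sentence → ℕ} (hg : IsGoedelNumbering g) :
    Function.Injective (fmCode : Fm L n → ℕ) := by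
  obtain ⟨hinj, ⟨p, -, hp⟩, -⟩ := hg
  intro φ ψ h
  apply alls_injective
  apply hinj
  have h₁ := hp φ.alls
  have h₂ := hp ψ.alls
  rw [fmCode_alls] at h₁ h₂
  rw [h] at h₁
  exact Part.mem_unique h₁ h₂

end Codes

/-- `x` is the code of one of the formulas in the variables `0, …, n - 1` whose universal closures
are the logical axioms. -/
def IsAxiomCode (n x : ℕ) : Prop :=
  (∃ a b, IsFmCode L n a ∧ IsFmCode L n b ∧ x = impCode a (impCode b a)) ∨
  (∃ a b c, IsFmCode L n a ∧ IsFmCode L n b ∧ IsFmCode L n c ∧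
    x = impCode (impCode a (impCode b c)) (impCode (impCode a b) (impCode a c))) ∨
  (∃ a, IsFmCode L n a ∧ x = impCode (notCode (notCode a)) a) ∨
  (∃ a t d, IsInstCode L n a t d ∧ x = impCode (allCode a) d) ∨
  (∃ a b, IsFmCode L (n + 1) a ∧ IsFmCode L (n + 1) b ∧
    x = impCode (allCode (impCode a b)) (impCode (allCode a) (allCode b))) ∨
  (∃ a d, IsLiftCode L n a d ∧ x = impCode a (allCode d)) ∨
  (x = notCode (allCode (Nat.pair 0 0))) ∨
  (∃ t, IsTmCode L n t ∧ x = eqCode t t) ∨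
  (∃ a s t d e, IsInstCode L n a s d ∧ IsInstCode L n a t e ∧
    x = impCode (eqCode s t) (impCode d e))

theorem rePred_isAxiomCode [Finite L.Symbols] {α : Type*} [Primcodable α] {f g : α → ℕ}
    (hf : Computable f) (hg : Computable g) : REPred fun a => IsAxiomCode L (f a) (g a) := by
  unfold IsAxiomCode
  repeat' first
    | with_reducible apply REPred.or
    | with_reducible apply REPred.exists
    | with_reducible apply REPred.and
    | with_reducible apply rePred_isTmCode
    | with_reducible apply rePred_isFmCode
    | with_reducible apply rePred_isInstCode
    | with_reducible apply rePred_isLiftCode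
    | with_reducible apply rePred_eq
  all_goals fun_prop

variable {L}

theorem isAxiomCode_iff {g : L.Sentence → ℕ} (hg : IsGoedelNumbering g) {n x : ℕ} :
    IsAxiomCode L n x ↔ ∃ φ : Fm L n, LogicalAxiom φ ∧ fmCode φ = x := by
  constructor
  · rintro (⟨_, _, ⟨φ, rfl⟩, ⟨ψ, rfl⟩, rfl⟩ | ⟨_, _, _, ⟨φ, rfl⟩, ⟨ψ, rfl⟩, ⟨χ, rfl⟩, rfl⟩ |
      ⟨_, ⟨φ, rfl⟩, rfl⟩ | ⟨_, _, _, ⟨φ, t, rfl, rfl, rfl⟩, rfl⟩ | ⟨_, _, ⟨φ, rfl⟩, ⟨ψ, rfl⟩, rfl⟩ |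
      ⟨_, _, ⟨φ, rfl, rfl⟩, rfl⟩ | rfl | ⟨_, ⟨t, rfl⟩, rfl⟩ |
      ⟨_, _, _, _, _, ⟨φ, s, rfl, rfl, rfl⟩, ⟨φ', t, h, rfl, rfl⟩, rfl⟩)
    · exact ⟨_, .imp_intro φ ψ, by simp only [fmCode_imp]⟩
    · exact ⟨_, .imp_distrib φ ψ χ, by simp only [fmCode_imp]⟩
    · exact ⟨_, .not_not φ, by simp only [fmCode_imp, fmCode_not]⟩
    · exact ⟨_, .all_elim φ t, by simp only [fmCode_imp, fmCode_all]⟩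
    · exact ⟨_, .all_distrib φ ψ, by simp only [fmCode_imp, fmCode_all]⟩
    · exact ⟨_, .all_vacuous φ, by simp only [fmCode_imp, fmCode_all]⟩
    · exact ⟨_, .nonempty, by rw [fmCode_not, fmCode_all, fmCode]⟩
    · exact ⟨_, .eq_refl t, by simp only [fmCode_equal]⟩
    -- The two instances come with formulas of equal code.
    · obtain rfl := fmCode_injective hg h
      exact ⟨_, .eq_subst φ' s t, by simp only [fmCode_imp, fmCode_equal]⟩
  · rintro ⟨φ, h, rfl⟩
    cases h with
    | imp_intro φ ψ =>
      exact .inl ⟨_, _, ⟨φ, rfl⟩, ⟨ψ, rfl⟩, by simp only [fmCode_imp]⟩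
    | imp_distrib φ ψ χ =>
      exact .inr <| .inl ⟨_, _, _, ⟨φ, rfl⟩, ⟨ψ, rfl⟩, ⟨χ, rfl⟩, by simp only [fmCode_imp]⟩
    | not_not φ =>
      exact .inr <| .inr <| .inl ⟨_, ⟨φ, rfl⟩, by simp only [fmCode_imp, fmCode_not]⟩
    | all_elim φ t =>
      exact .inr <| .inr <| .inr <| .inl ⟨_, _, _, ⟨φ, t, rfl, rfl, rfl⟩,
        by simp only [fmCode_imp, fmCode_all]⟩
    | all_distrib φ ψ =>
      exact .inr <| .inr <| .inr <| .inr <| .inl ⟨_, _, ⟨φ, rfl⟩, ⟨ψ, rfl⟩,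
        by simp only [fmCode_imp, fmCode_all]⟩
    | all_vacuous φ =>
      exact .inr <| .inr <| .inr <| .inr <| .inr <| .inl ⟨_, _, ⟨φ, rfl, rfl⟩,
        by simp only [fmCode_imp, fmCode_all]⟩
    | nonempty =>
      exact .inr <| .inr <| .inr <| .inr <| .inr <| .inr <| .inl
        (by rw [fmCode_not, fmCode_all, fmCode])
    | eq_refl t =>
      exact .inr <| .inr <| .inr <| .inr <| .inr <| .inr <| .inr <| .inl ⟨_, ⟨t, rfl⟩,
        by simp only [fmCode_equal]⟩
    | eq_subst φ s t =>
      exact .inr <| .inr <| .inr <| .inr <| .inr <| .inr <| .inr <| .inr ⟨_, _, _, _, _,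
        ⟨φ, s, rfl, rfl, rfl⟩, ⟨φ, t, rfl, rfl, rfl⟩, by simp only [fmCode_imp, fmCode_equal]⟩

end Axioms

/-! ### The complexity of the property of being an effectively inseparable theory -/

section Theories

open Nat.Partrec (Code)
open Encodable (encode)

/-- Effective inseparability with the `Σ⁰₃` definition on the right: it suffices to consider the
supersets of `A` and `B` that are of the form `A ∪ W i` and `B ∪ W j`, for which being disjoint is a
`Π⁰₁` condition and there is no inclusion left to state.  The number `k` is an index of the total
function `f`. -/
theorem effectivelyInseparable_iff {A B : Set ℕ} (hA : REPred fun x => x ∈ A)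
    (hB : REPred fun x => x ∈ B) :
    EffectivelyInseparable A B ↔ (∀ x, ¬ (x ∈ A ∧ x ∈ B)) ∧
      ∃ k : ℕ, (∀ n, ∃ v, v ∈ (Denumerable.ofNat Code k).eval n) ∧
        ∀ i j v, v ∈ (Denumerable.ofNat Code k).eval (Nat.pair i j) →
          (∃ x, (x ∈ A ∨ x ∈ W i) ∧ (x ∈ B ∨ x ∈ W j)) ∨
            ¬ ((v ∈ A ∨ v ∈ W i) ∨ (v ∈ B ∨ v ∈ W j)) := by
  have hd : A ∩ B = ∅ ↔ ∀ x, ¬ (x ∈ A ∧ x ∈ B) := Set.eq_empty_iff_forall_notMem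
  constructor
  · rintro ⟨-, -, h, f, hf, H⟩
    -- `s i` and `t j` are indices of `A ∪ W i` and `B ∪ W j`.
    refine ⟨hd.1 h, ?_⟩
    obtain ⟨s, hs, hs'⟩ := exists_computable_index (p := fun i x : ℕ => x ∈ A ∨ x ∈ W i)
      ((hA.comp Computable.snd).or (rePred_mem_W (by fun_prop) (by fun_prop)))
    obtain ⟨t, ht, ht'⟩ := exists_computable_index (p := fun i x : ℕ => x ∈ B ∨ x ∈ W i)
      ((hB.comp Computable.snd).or (rePred_mem_W (by fun_prop) (by fun_prop)))
    have hF : Computable fun n : ℕ => f (s n.unpair.1) (t n.unpair.2) :=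
      hf.comp (by fun_prop) (by fun_prop)
    obtain ⟨c, hc⟩ := Code.exists_code.1 (Partrec.nat_iff.1 hF.partrec)
    refine ⟨encode c, fun n => by simp [hc], fun i j v hv => ?_⟩
    have hv : v = f (s i) (t j) := by simpa [hc] using hv
    subst hv
    refine or_iff_not_imp_left.2 fun hx => ?_
    have := H (s i) (t j) (fun x hx => (hs' _ _).2 (.inl hx)) (fun x hx => (ht' _ _).2 (.inl hx))
      (Set.eq_empty_iff_forall_notMem.2 fun x hx' =>
        hx ⟨x, (hs' _ _).1 hx'.1, (ht' _ _).1 hx'.2⟩)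
    simpa only [Set.mem_union, hs', ht'] using this
  · rintro ⟨h, k, htot, H⟩
    refine ⟨hA, hB, hd.2 h, ?_⟩
    choose F hF using htot
    have hFc : Computable F :=
      (Code.eval_part.comp (Computable.const (Denumerable.ofNat Code k)) Computable.id).of_eq
        fun n => Part.eq_some_iff.2 (hF n)
    refine ⟨fun i j => F (Nat.pair i j), hFc.comp Primrec₂.natPair.to_comp, fun i j hi hj hij => ?_⟩
    rcases H i j _ (hF _) with ⟨x, hx, hx'⟩ | hv
    · have : x ∈ W i ∩ W j := ⟨hx.elim (fun h => hi h) id, hx'.elim (fun h => hj h) id⟩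
      simp [hij] at this
    · exact fun h => hv (h.imp .inr .inr)

variable {L : FirstOrder.Language.{u, v}}

/-- A set of sentences is a theory if and only if it contains the logical axioms and is closed under
modus ponens. -/
theorem isTheory_iff {T : Set L.Sentence} :
    IsTheory T ↔ (∀ n (φ : Fm L n), LogicalAxiom φ → (φ.alls : L.Sentence) ∈ T) ∧
      ∀ φ ψ : L.Sentence, (BoundedFormula.imp φ ψ : L.Sentence) ∈ T → φ ∈ T → ψ ∈ T := by
  constructor
  · intro h
    have h' (φ : L.Sentence) : φ ∈ T ↔ Provable T φ := by
      conv_lhs => rw [← h]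
      rfl
    simp only [h']
    exact ⟨fun n φ hφ => .logical hφ, fun φ ψ => .mp⟩
  · rintro ⟨h₁, h₂⟩
    refine Set.Subset.antisymm (fun φ (hφ : Provable T φ) => ?_) fun φ => .hyp
    induction hφ with
    | hyp h => exact h
    | logical h => exact h₁ _ _ h
    | mp _ _ ih₁ ih₂ => exact h₂ _ _ ih₁ ih₂

/-- The numbers of the sentences whose negations have their numbers in `X`. -/
def negationPreimage (g : L.Sentence → ℕ) (X : Set ℕ) : Set ℕ :=
  {y | ∃ φ : L.Sentence, g φ = y ∧ g (BoundedFormula.not φ) ∈ X}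

/-- The property of being an effectively inseparable theory in terms of the set `X` of numbers
alone.  The nuclei of a theory with the set of numbers `X` are `X` and `negationPreimage g X`. -/
theorem isEITheory_iff {g : L.Sentence → ℕ} (hg : Function.Injective g) {X : Set ℕ} :
    IsEITheory g X ↔ (∀ x, x ∈ X → ∃ φ, g φ = x) ∧
      (∀ x, (∃ n, ∃ φ : Fm L n, LogicalAxiom φ ∧ g φ.alls = x) → x ∈ X) ∧
      (∀ x y z, (∃ φ ψ : L.Sentence, g (BoundedFormula.imp φ ψ) = x ∧ g φ = y ∧ g ψ = z) →
        x ∈ X ∧ y ∈ X → z ∈ X) ∧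
      ¬ g (BoundedFormula.falsum : Fm L 0) ∈ X ∧
      EffectivelyInseparable X (negationPreimage g X) := by
  have key {T : Set L.Sentence} (hT : IsTheory T) : provableNumbers g T = g '' T ∧
      refutableNumbers g T = negationPreimage g (g '' T) := by
    have h' (φ : L.Sentence) : Provable T φ ↔ φ ∈ T := by
      conv_rhs => rw [← hT]
      rfl
    refine ⟨by rw [provableNumbers, hT], ?_⟩
    ext y
    constructor
    · rintro ⟨φ, h, rfl⟩
      exact ⟨φ, rfl, _, (h' _).1 h, rfl⟩
    · rintro ⟨φ, rfl, h⟩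
      exact ⟨φ, (h' _).2 (hg.mem_set_image.1 h), rfl⟩
  constructor
  · rintro ⟨T, rfl, hT, hcon, hEI⟩
    rw [(key hT).1, (key hT).2] at hEI
    obtain ⟨h₁, h₂⟩ := isTheory_iff.1 hT
    refine ⟨?_, ?_, ?_, ?_, hEI⟩
    · rintro _ ⟨φ, -, rfl⟩
      exact ⟨φ, rfl⟩
    · rintro _ ⟨n, φ, hφ, rfl⟩
      exact ⟨_, h₁ n φ hφ, rfl⟩
    · rintro _ _ _ ⟨φ, ψ, rfl, rfl, rfl⟩ ⟨hx, hy⟩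
      exact ⟨_, h₂ φ ψ (hg.mem_set_image.1 hx) (hg.mem_set_image.1 hy), rfl⟩
    · exact fun h => hcon (.hyp (hg.mem_set_image.1 h))
  · rintro ⟨hX, hax, hmp, hcon, hEI⟩
    have hT : IsTheory (g ⁻¹' X) := isTheory_iff.2 ⟨fun n φ hφ => hax _ ⟨n, φ, hφ, rfl⟩,
      fun φ ψ h₁ h₂ => hmp _ _ _ ⟨φ, ψ, rfl, rfl, rfl⟩ ⟨h₁, h₂⟩⟩
    have hgX : g '' (g ⁻¹' X) = X := Set.image_preimage_eq_of_subset fun x hx => hX x hx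
    refine ⟨g ⁻¹' X, hgX, hT, fun h => hcon ?_, ?_⟩
    · have : (BoundedFormula.falsum : Fm L 0) ∈ {φ | Provable (g ⁻¹' X) φ} := h
      rw [hT] at this
      exact this
    · rw [(key hT).1, (key hT).2, hgX]
      exact hEI

variable [Finite L.Symbols] [Encodable (Σ n, L.Functions n)] [Encodable (Σ n, L.Relations n)]
variable {g : L.Sentence → ℕ} {α : Type*} [Primcodable α]

/-- The set of Gödel numbers is recursively enumerable. -/
theorem rePred_number (hg : IsGoedelNumbering g) {f : α → ℕ} (hf : Computable f) :
    REPred fun a => ∃ φ, g φ = f a := by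
  obtain ⟨-, ⟨p, hp, hpg⟩, -⟩ := hg
  have : REPred fun a => ∃ c, IsFmCode L 0 c ∧ f a ∈ p c :=
    .exists (.and (rePred_isFmCode L (by fun_prop) (by fun_prop))
      (rePred_mem_partrec hp (by fun_prop) (by fun_prop)))
  refine this.of_eq fun a => ⟨?_, ?_⟩
  · rintro ⟨_, ⟨φ, rfl⟩, h⟩
    exact ⟨φ, Part.mem_unique (hpg φ) h⟩
  · rintro ⟨φ, h⟩
    exact ⟨_, ⟨φ, rfl⟩, h ▸ hpg φ⟩

theorem rePred_axiom_number (hg : IsGoedelNumbering g) {f : α → ℕ} (hf : Computable f) :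
    REPred fun a => ∃ n, ∃ φ : Fm L n, LogicalAxiom φ ∧ g φ.alls = f a := by
  obtain ⟨p, hp, hpg⟩ := hg.2.1
  have : REPred fun a => ∃ n c, IsAxiomCode L n c ∧ f a ∈ p (allCode^[n] c) :=
    .exists (.exists (.and (rePred_isAxiomCode L (by fun_prop) (by fun_prop))
      (rePred_mem_partrec hp (by fun_prop) (by fun_prop))))
  refine this.of_eq fun a => exists_congr fun n => ?_
  simp only [isAxiomCode_iff hg]
  constructor
  · rintro ⟨_, ⟨φ, hφ, rfl⟩, h⟩
    rw [← fmCode_alls] at h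
    exact ⟨φ, hφ, Part.mem_unique (hpg φ.alls) h⟩
  · rintro ⟨φ, hφ, h⟩
    refine ⟨_, ⟨φ, hφ, rfl⟩, ?_⟩
    rw [← fmCode_alls, ← h]
    exact hpg φ.alls

theorem rePred_imp_number (hg : IsGoedelNumbering g) {f₁ f₂ f₃ : α → ℕ} (hf₁ : Computable f₁)
    (hf₂ : Computable f₂) (hf₃ : Computable f₃) :
    REPred fun a => ∃ φ ψ : L.Sentence,
      g (BoundedFormula.imp φ ψ) = f₁ a ∧ g φ = f₂ a ∧ g ψ = f₃ a := by
  obtain ⟨-, ⟨p, hp, hpg⟩, -⟩ := hg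
  have : REPred fun a => ∃ c d, IsFmCode L 0 c ∧ IsFmCode L 0 d ∧ f₁ a ∈ p (impCode c d) ∧
      f₂ a ∈ p c ∧ f₃ a ∈ p d :=
    .exists (.exists (.and (rePred_isFmCode L (by fun_prop) (by fun_prop))
      (.and (rePred_isFmCode L (by fun_prop) (by fun_prop))
      (.and (rePred_mem_partrec hp (by fun_prop) (by fun_prop))
      (.and (rePred_mem_partrec hp (by fun_prop) (by fun_prop))
      (rePred_mem_partrec hp (by fun_prop) (by fun_prop)))))))
  refine this.of_eq fun a => ⟨?_, ?_⟩
  · rintro ⟨_, _, ⟨φ, rfl⟩, ⟨ψ, rfl⟩, h₁, h₂, h₃⟩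
    rw [← fmCode_imp] at h₁
    exact ⟨φ, ψ, Part.mem_unique (hpg _) h₁, Part.mem_unique (hpg _) h₂,
      Part.mem_unique (hpg _) h₃⟩
  · rintro ⟨φ, ψ, h₁, h₂, h₃⟩
    refine ⟨_, _, ⟨φ, rfl⟩, ⟨ψ, rfl⟩, ?_, h₂ ▸ hpg φ, h₃ ▸ hpg ψ⟩
    rw [← fmCode_imp, ← h₁]
    exact hpg _

theorem rePred_not_number (hg : IsGoedelNumbering g) {f₁ f₂ : α → ℕ} (hf₁ : Computable f₁)
    (hf₂ : Computable f₂) :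
    REPred fun a => ∃ φ : L.Sentence, g φ = f₁ a ∧ g (BoundedFormula.not φ) = f₂ a := by
  obtain ⟨-, ⟨p, hp, hpg⟩, -⟩ := hg
  have : REPred fun a => ∃ c, IsFmCode L 0 c ∧ f₁ a ∈ p c ∧ f₂ a ∈ p (notCode c) :=
    .exists (.and (rePred_isFmCode L (by fun_prop) (by fun_prop))
      (.and (rePred_mem_partrec hp (by fun_prop) (by fun_prop))
      (rePred_mem_partrec hp (by fun_prop) (by fun_prop))))
  refine this.of_eq fun a => ⟨?_, ?_⟩
  · rintro ⟨_, ⟨φ, rfl⟩, h₁, h₂⟩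
    rw [← fmCode_not] at h₂
    exact ⟨φ, Part.mem_unique (hpg _) h₁, Part.mem_unique (hpg _) h₂⟩
  · rintro ⟨φ, h₁, h₂⟩
    refine ⟨_, ⟨φ, rfl⟩, h₁ ▸ hpg φ, ?_⟩
    rw [← fmCode_not, ← h₂]
    exact hpg _

theorem rePred_mem_negationPreimage (hg : IsGoedelNumbering g) {e f : α → ℕ} (he : Computable e)
    (hf : Computable f) : REPred fun a => f a ∈ negationPreimage g (W (e a)) := by
  have : REPred fun a => ∃ x, (∃ φ : L.Sentence, g φ = f a ∧ g (BoundedFormula.not φ) = x) ∧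
      x ∈ W (e a) :=
    .exists (.and (rePred_not_number hg (by fun_prop) (by fun_prop))
      (rePred_mem_W (by fun_prop) (by fun_prop)))
  refine this.of_eq fun a => ⟨?_, ?_⟩
  · rintro ⟨_, ⟨φ, h, rfl⟩, h'⟩
    exact ⟨φ, h, h'⟩
  · rintro ⟨φ, h, h'⟩
    exact ⟨_, ⟨φ, h, rfl⟩, h'⟩

end Theories

end EITheory

theorem mainTheorem9 {L : FirstOrder.Language.{u, v}} [Finite L.Symbols]
    [Encodable (Σ n, L.Functions n)] [Encodable (Σ n, L.Relations n)]
    (g : L.Sentence → ℕ) (hg : EITheory.IsGoedelNumbering g) :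
    EITheory.IsSigma 3 {e | EITheory.IsEITheory g (EITheory.W e)} := by
  open EITheory in
  have hEI (e : ℕ) := effectivelyInseparable_iff
    (rePred_mem_W (computable_const' e) computable_id')
    (rePred_mem_negationPreimage hg (computable_const' e) computable_id')
  simp only [isEITheory_iff hg.1, hEI, ← exists_and_left]
  apply isSigma_three_of_exists_isPi2
  -- The existential quantifier over an index `k` of the productive function is in front; each of
  -- the conditions that remain is `Π⁰₂`.
  refine .and (.forall_nat (.imp_of_rePred ?_ (REPred.isPi2 ?_)))
    (.and (.forall_nat (.imp_of_rePred ?_ (REPred.isPi2 ?_)))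
    (.and (.forall_nat (.forall_nat (.forall_nat (.imp_of_rePred ?_ (.imp_of_rePred (.and ?_ ?_)
      (REPred.isPi2 ?_))))))
    (.and (REPred.isPi2_not ?_) (.and (.forall_nat (REPred.isPi2_not (.and ?_ ?_)))
    (.and (.forall_nat (REPred.isPi2 (.exists ?_)))
    (.forall_nat (.forall_nat (.forall_nat (.imp_of_rePred ?_ (.or
      (REPred.isPi2 (.exists (.and (.or ?_ ?_) (.or ?_ ?_))))
      (REPred.isPi2_not (.or (.or ?_ ?_) (.or ?_ ?_)))))))))))))
  all_goals first
    | exact rePred_mem_W (by fun_prop) (by fun_prop)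
    | exact rePred_mem_eval (by fun_prop) (by fun_prop) (by fun_prop)
    | exact rePred_number hg (by fun_prop)
    | exact rePred_axiom_number hg (by fun_prop)
    | exact rePred_imp_number hg (by fun_prop) (by fun_prop) (by fun_prop)
    | exact rePred_mem_negationPreimage hg (by fun_prop) (by fun_prop)
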